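/- Consider the planar system $\dot x = xy - x^2y$, $\dot y = y^2+\frac14x^3+\frac14x^2+\frac14x+\frac14$, with first integral $$H(x,y)=\tfrac1{16}x^{-2}(x-1)^2(x^2+2x+1+4y^2).$$ For $h>0$ let $\Gamma_h=\{(x,y): x<0,\ H(x,y)=h\}$, the periodic orbit around the centre $(-1,0)$. It is a closed curve admitting a regular $C^1$ parametrization that runs through it exactly once in the direction of the flow (counterclockwise). With this orientation put $$I_{i,j}(h)=\oint_{\Gamma_h}(x-1)x^{i-3}y^j\,dx .$$ Let $K(k)=\int_0^{\pi/2}\frac{d\theta}{\sqrt{1-k^2\sin^2\theta}}$ and $E(k)=\int_0^{\pi/2}\sqrt{1-k^2\sin^2\theta}\,d\theta$ be the complete elliptic integrals of the first and second kind. Then, for every $h>0$, $$I_{1,1}(h)=\frac{16h+2}{\sqrt{8h+1+4\sqrt{4h^2+h}}}\,K(k)-\frac{2}{\sqrt{8h+1-4\sqrt{4h^2+h}}}\,E(k),$$ $$I_{3,1}(h)=\frac{16h+2}{3\sqrt{8h+1-4\sqrt{4h^2+h}}}\,E(k)-\frac{16h+2-8\sqrt{4h^2+h}}{3\sqrt{8h+1-4\sqrt{4h^2+h}}}\,K(k),$$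 $$I_{0,1}(h)=-4\pi h,\qquad I_{2,1}(h)=-4\pi h,$$ where $$k=2\sqrt2\,\sqrt{\frac{\sqrt{4h^2+h}}{8h+1+4\sqrt{4h^2+h}}},\qquad 0<k<1 .$$ -/

import Mathlib

open Set Real

/-- The first integral `H(x,y) = x⁻² (x-1)² (x² + 2x + 1 + 4y²) / 16` of the unperturbed system. -/
noncomputable def firstIntegral (p : ℝ × ℝ) : ℝ :=
  (1 / 16) * (p.1 ^ 2)⁻¹ * (p.1 - 1) ^ 2 * (p.1 ^ 2 + 2 * p.1 + 1 + 4 * p.2 ^ 2)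

/-- The unperturbed vector field
`x' = x y - x² y`, `y' = y² + x³/4 + x²/4 + x/4 + 1/4`. -/
noncomputable def vectorField (p : ℝ × ℝ) : ℝ × ℝ :=
  (p.1 * p.2 - p.1 ^ 2 * p.2,
    p.2 ^ 2 + p.1 ^ 3 / 4 + p.1 ^ 2 / 4 + p.1 / 4 + 1 / 4)

/-- The periodic orbit `Γ_h` around the centre `(-1, 0)`: the part of the level set `H = h` lying in
the half plane `x < 0`, which contains the centre. (The singular line `x = 0` of `H` separates it
from the rest of the level set, which is unbounded and lies in `x > 0`.) -/
def orbit (h : ℝ) : Set (ℝ × ℝ) :=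
  {p | p.1 < 0 ∧ firstIntegral p = h}

/-- `γ`, restricted to `[a, b]`, is a regular `C¹` parametrization of the closed curve `Γ_h` which
runs through it exactly once, in the direction of the flow (that is, counterclockwise). -/
structure IsOrbitParam (h a b : ℝ) (γ : ℝ → ℝ × ℝ) : Prop where
  lt : a < b
  contDiffOn : ContDiffOn ℝ 1 γ (Icc a b)
  closed : γ a = γ b
  injOn : InjOn γ (Ico a b)
  image_eq : γ '' Icc a b = orbit h
  flow : ∀ t ∈ Icc a b, ∃ c : ℝ, 0 < c ∧ derivWithin γ (Icc a b) t = c • vectorField (γ t)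

/-- The line integral `∫ (x-1) x^{i-3} y^j dx` along the curve `γ` on `[a, b]`. It is
`I_{i,j}(h)` when `γ` parametrizes `Γ_h`. -/
noncomputable def orbitIntegral (i j : ℕ) (a b : ℝ) (γ : ℝ → ℝ × ℝ) : ℝ :=
  ∫ t in a..b, ((γ t).1 - 1) * (γ t).1 ^ ((i : ℤ) - 3) * (γ t).2 ^ j *
    (derivWithin γ (Icc a b) t).1

/-- The complete elliptic integral of the first kind, with modulus `k`. -/
noncomputable def ellipticK (k : ℝ) : ℝ :=
  ∫ θ in (0 : ℝ)..(π / 2), 1 / √(1 - k ^ 2 * sin θ ^ 2)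

/-- The complete elliptic integral of the second kind, with modulus `k`. -/
noncomputable def ellipticE (k : ℝ) : ℝ :=
  ∫ θ in (0 : ℝ)..(π / 2), √(1 - k ^ 2 * sin θ ^ 2)

/-- The modulus `k(h)`. -/
noncomputable def modulus (h : ℝ) : ℝ :=
  2 * √2 * √(√(4 * h ^ 2 + h) / (8 * h + 1 + 4 * √(4 * h ^ 2 + h)))

/-! In the coordinates `u = (x - 1/x)/2`, `v = y (1 - 1/x)` the orbit is the circle of radius `b =
2√h` (`firstIntegral_eq`), and the flow rotates it counterclockwise at rate `(x² + 1)/2`. With the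
polar angle `θ` as parameter, `I_{i,1}` becomes the integral over one turn of `b² sin² θ x^(i-1) /
√(1 + b² cos² θ)`.

The half turn `θ ↦ θ + π` replaces `x` by `1/x`. Adding the two halves, the radical cancels for `i =
0, 2`, leaving a multiple of `sin² θ`; for `i = 1, 3` only odd powers of the radical remain, and
`integral_radical_cube` removes the third power. With `a² = 1 + b²`, Landen's transformation turns
the remaining two integrals into `K(k)` and `E(k)`, `k² = 4ab/(a+b)²`.

Independence of the parametrization comes from a continuous angle function: it increases strictly,
and injectivity together with closedness forces exactly one turn (`IsOrbitParam.angle_end`). -/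

/-- The radical `√(1 + b² cos² φ)`, to which the elliptic integrands of the orbit reduce. -/
noncomputable def radical (b φ : ℝ) : ℝ := √(1 + b ^ 2 * cos φ ^ 2)

lemma radical_pos (b φ : ℝ) : 0 < radical b φ := Real.sqrt_pos.2 (by positivity)

lemma radical_sq (b φ : ℝ) : radical b φ ^ 2 = 1 + b ^ 2 * cos φ ^ 2 :=
  Real.sq_sqrt (by positivity)

lemma abs_lt_radical (b φ : ℝ) : |b * cos φ| < radical b φ := by
  apply abs_lt_of_sq_lt_sq _ (radical_pos b φ).le
  rw [radical_sq]; nlinarith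

lemma radical_add_pos (b φ : ℝ) : 0 < radical b φ + b * cos φ := by
  linarith [neg_abs_le (b * cos φ), abs_lt_radical b φ]

@[fun_prop]
lemma continuous_radical (b : ℝ) : Continuous (radical b) := by
  unfold radical; fun_prop

lemma hasDerivAt_radical (b φ : ℝ) :
    HasDerivAt (radical b) (-(b ^ 2 * sin φ * cos φ) / radical b φ) φ := by
  have h1 : HasDerivAt (fun φ => 1 + b ^ 2 * cos φ ^ 2)
      (b ^ 2 * (2 * cos φ * (-sin φ))) φ := by
    have := (((hasDerivAt_cos φ).pow 2).const_mul (b ^ 2)).const_add 1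
    simpa using this
  have h2 := h1.sqrt (by positivity)
  refine h2.congr_deriv ?_
  change _ / (2 * radical b φ) = _
  have := (radical_pos b φ).ne'
  field_simp

lemma continuous_radical_inv (b : ℝ) : Continuous fun φ => 1 / radical b φ :=
  continuous_const.div (continuous_radical b) fun φ => (radical_pos b φ).ne'

/-- The relation between the moments of the radical that comes from differentiating
`sin φ cos φ √(1 + b² cos² φ)`. -/
lemma integral_radical_cube (b : ℝ) :
    3 * ∫ φ in (0 : ℝ)..π, radical b φ ^ 3 =
      2 * (2 + b ^ 2) * (∫ φ in (0 : ℝ)..π, radical b φ)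
        - (1 + b ^ 2) * ∫ φ in (0 : ℝ)..π, 1 / radical b φ := by
  -- With the factor `b ^ 2`, both `b² cos² φ` and `b² sin² φ` are polynomials in the radical, so
  -- the derivative involves only its powers.
  have hd : ∀ φ ∈ uIcc 0 π, HasDerivAt (fun φ => b ^ 2 * (sin φ * cos φ * radical b φ))
      (3 * radical b φ ^ 3 - 2 * (2 + b ^ 2) * radical b φ
        + (1 + b ^ 2) * (1 / radical b φ)) φ := by
    intro φ _
    have h1 := (((hasDerivAt_sin φ).mul (hasDerivAt_cos φ)).mul
      (hasDerivAt_radical b φ)).const_mul (b ^ 2)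
    refine h1.congr_deriv ?_
    have hs := radical_sq b φ
    have h0 := (radical_pos b φ).ne'
    have hc := sin_sq_add_cos_sq φ
    simp only [Pi.mul_apply]
    generalize radical b φ = D at *
    generalize sin φ = s at *
    generalize cos φ = c at *
    obtain hs2 : s ^ 2 = 1 - c ^ 2 := by linarith
    field_simp
    rw [hs, hs2]
    ring
  have hi := continuous_radical_inv b
  have hr := continuous_radical b
  have key := intervalIntegral.integral_eq_sub_of_hasDerivAt hd
    (Continuous.intervalIntegrable (by fun_prop) _ _)
  rw [intervalIntegral.integral_add (Continuous.intervalIntegrable (by fun_prop) _ _)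
    (Continuous.intervalIntegrable (by fun_prop) _ _),
    intervalIntegral.integral_sub (Continuous.intervalIntegrable (by fun_prop) _ _)
    (Continuous.intervalIntegrable (by fun_prop) _ _)] at key
  simp only [intervalIntegral.integral_const_mul, sin_pi, sin_zero] at key
  linarith

/-! ### Landen's transformation -/

section Landen

variable {a b : ℝ}

/-- Landen's change of variable `t = φ + arcsin ((b / a) sin φ)`. -/
lemma integral_comp_landen (ha : 0 < a) (hb : 0 ≤ b) (hab : a ^ 2 = 1 + b ^ 2)
    {g : ℝ → ℝ} (hg : ContinuousOn g (Ioi 0)) :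
    ∫ t in (0 : ℝ)..π, g (√(a ^ 2 + b ^ 2 + 2 * a * b * cos t)) =
      ∫ φ in (0 : ℝ)..π, g (radical b φ + b * cos φ) *
        ((radical b φ + b * cos φ) / radical b φ) := by
  have hlt : b < a := by nlinarith
  set f : ℝ → ℝ := fun φ => φ + arcsin (b / a * sin φ) with hf
  have hq : b / a < 1 := (div_lt_one ha).2 hlt
  have hq0 : 0 ≤ b / a := by positivity
  have habs : ∀ φ, |b / a * sin φ| < 1 := fun φ => by
    rw [abs_mul, abs_of_nonneg hq0]
    nlinarith [abs_sin_le_one φ, abs_nonneg (sin φ)]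
  have hcos : ∀ φ, √(1 - (b / a * sin φ) ^ 2) = radical b φ / a := fun φ => by
    rw [Real.sqrt_eq_iff_eq_sq]
    · rw [div_pow, radical_sq]
      have := sin_sq_add_cos_sq φ
      have hs : sin φ ^ 2 = 1 - cos φ ^ 2 := by linarith
      field_simp
      rw [hab, hs]; ring
    · have := (sq_lt_one_iff_abs_lt_one _).2 (habs φ)
      linarith
    · exact div_nonneg (radical_pos b φ).le ha.le
  have hder : ∀ φ, HasDerivAt f ((radical b φ + b * cos φ) / radical b φ) φ := fun φ => by
    have h1 := (hasDerivAt_arcsin (x := b / a * sin φ)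
      (by have := abs_lt.1 (habs φ); linarith) (by have := abs_lt.1 (habs φ); linarith)).comp φ
      ((hasDerivAt_sin φ).const_mul (b / a))
    refine ((hasDerivAt_id φ).add h1).congr_deriv ?_
    rw [hcos]
    have := (radical_pos b φ).ne'
    field_simp
  -- Here `a cos (f φ) = cos φ · radical b φ - b sin² φ`, which makes the radicand a perfect square.
  have hr : ∀ φ, √(a ^ 2 + b ^ 2 + 2 * a * b * cos (f φ)) = radical b φ + b * cos φ := fun φ => by
    have e : a ^ 2 + b ^ 2 + 2 * a * b * cos (f φ) = (radical b φ + b * cos φ) ^ 2 := by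
      have h1 := abs_lt.1 (habs φ)
      simp only [hf]
      rw [cos_add, cos_arcsin, sin_arcsin h1.1.le h1.2.le, hcos]
      have := sin_sq_add_cos_sq φ
      have hs : sin φ ^ 2 = 1 - cos φ ^ 2 := by linarith
      have hD := radical_sq b φ
      field_simp
      rw [hab, hs]
      linear_combination -hD
    rw [e, Real.sqrt_sq (radical_add_pos b φ).le]
  have key := intervalIntegral.integral_comp_mul_deriv (a := 0) (b := π) (f := f)
    (g := fun t => g (√(a ^ 2 + b ^ 2 + 2 * a * b * cos t)))
    (fun φ _ => hder φ)
    (Continuous.continuousOn (((continuous_radical b).add (by fun_prop)).div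
      (continuous_radical b) fun φ => (radical_pos b φ).ne'))
    (hg.comp_continuous (by fun_prop) fun t => Real.sqrt_pos.2 (by
      nlinarith [mul_nonneg ha.le hb, neg_one_le_cos t, sq_pos_of_pos (sub_pos.2 hlt)]))
  have h0 : f 0 = 0 := by simp [hf]
  have hpi : f π = π := by simp [hf]
  rw [h0, hpi] at key
  rw [← key]
  simp only [Function.comp, hr]

lemma radicand_landen (ha : 0 < a) (hb : 0 ≤ b) {k : ℝ} (hk : k ^ 2 = 4 * a * b / (a + b) ^ 2)
    (θ : ℝ) : √(1 - k ^ 2 * sin θ ^ 2) =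
      √(a ^ 2 + b ^ 2 + 2 * a * b * cos (2 * θ)) / (a + b) := by
  have h : 0 < a + b := by positivity
  rw [eq_div_iff h.ne']
  nth_rewrite 1 [← Real.sqrt_sq h.le]
  rw [← Real.sqrt_mul' _ (by positivity), hk]
  congr 1
  have := sin_sq_add_cos_sq θ
  rw [cos_two_mul]
  field_simp
  linear_combination (- 4 * a * b) * this

/-- Landen's transformation of the complete elliptic integral of the second kind. -/
lemma ellipticE_landen (ha : 0 < a) (hb : 0 ≤ b) (hab : a ^ 2 = 1 + b ^ 2)
    {k : ℝ} (hk : k ^ 2 = 4 * a * b / (a + b) ^ 2) :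
    ellipticE k = (2 * (∫ φ in (0 : ℝ)..π, radical b φ)
      - ∫ φ in (0 : ℝ)..π, 1 / radical b φ) / (2 * (a + b)) := by
  have hi := continuous_radical_inv b
  have h1 : ellipticE k = 2⁻¹ * ((a + b)⁻¹ *
      ∫ t in (0 : ℝ)..π, √(a ^ 2 + b ^ 2 + 2 * a * b * cos t)) := by
    unfold ellipticE
    simp only [radicand_landen ha hb hk]
    rw [intervalIntegral.integral_comp_mul_left
      (fun t => √(a ^ 2 + b ^ 2 + 2 * a * b * cos t) / (a + b)) two_ne_zero]
    simp only [div_eq_inv_mul _ (a + b), intervalIntegral.integral_const_mul, mul_zero,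
      smul_eq_mul]
    rw [mul_div_cancel₀ _ two_ne_zero]
  have h2 := integral_comp_landen ha hb hab continuousOn_id
  simp only [id] at h2
  -- The cosine term integrates to zero over `[0, π]`, leaving only the two moments.
  have h3 : ∀ φ, (radical b φ + b * cos φ) * ((radical b φ + b * cos φ) / radical b φ) =
      2 * radical b φ + 2 * b * cos φ - 1 / radical b φ := fun φ => by
    have hD := radical_sq b φ
    have h0 := (radical_pos b φ).ne'
    field_simp
    linear_combination -hD
  simp only [h3] at h2
  rw [intervalIntegral.integral_sub (Continuous.intervalIntegrable (by fun_prop) _ _)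
    (Continuous.intervalIntegrable (by fun_prop) _ _),
    intervalIntegral.integral_add (Continuous.intervalIntegrable (by fun_prop) _ _)
    (Continuous.intervalIntegrable (by fun_prop) _ _)] at h2
  simp only [intervalIntegral.integral_const_mul, integral_cos, sin_pi, sin_zero] at h2
  rw [h1, h2]
  have h : 0 < a + b := by positivity
  field_simp
  ring

/-- Landen's transformation of the complete elliptic integral of the first kind. -/
lemma ellipticK_landen (ha : 0 < a) (hb : 0 ≤ b) (hab : a ^ 2 = 1 + b ^ 2)
    {k : ℝ} (hk : k ^ 2 = 4 * a * b / (a + b) ^ 2) :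
    ellipticK k = (a + b) / 2 * ∫ φ in (0 : ℝ)..π, 1 / radical b φ := by
  have h1 : ellipticK k = 2⁻¹ * ((a + b) *
      ∫ t in (0 : ℝ)..π, 1 / √(a ^ 2 + b ^ 2 + 2 * a * b * cos t)) := by
    unfold ellipticK
    simp only [radicand_landen ha hb hk]
    rw [intervalIntegral.integral_comp_mul_left
      (fun t => 1 / (√(a ^ 2 + b ^ 2 + 2 * a * b * cos t) / (a + b))) two_ne_zero]
    simp only [one_div_div, div_eq_mul_one_div (a + b), intervalIntegral.integral_const_mul,
      mul_zero, smul_eq_mul]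
    rw [mul_div_cancel₀ _ two_ne_zero]
  have h2 := integral_comp_landen ha hb hab (g := fun x => 1 / x)
    (continuousOn_const.div continuousOn_id fun x hx => (mem_Ioi.1 hx).ne')
  have h3 : ∀ φ, 1 / (radical b φ + b * cos φ) * ((radical b φ + b * cos φ) / radical b φ) =
      1 / radical b φ := fun φ => by
    have h0 := (radical_pos b φ).ne'
    have h4 := (radical_add_pos b φ).ne'
    field_simp
  simp only [h3] at h2
  rw [h1, h2]
  ring

end Landen

/-! ### The integrals over the angle -/

/-- The abscissa of the point of the orbit at angle `θ`: the negative solution `x` of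
`x - 1 / x = 2 b cos θ`. -/
noncomputable def abscissa (b θ : ℝ) : ℝ := b * cos θ - radical b θ

lemma abscissa_neg (b θ : ℝ) : abscissa b θ < 0 := by
  have := abs_lt_radical b θ
  have := le_abs_self (b * cos θ)
  unfold abscissa
  linarith

lemma abscissa_mul (b θ : ℝ) : abscissa b θ * (b * cos θ + radical b θ) = -1 := by
  unfold abscissa
  linear_combination -radical_sq b θ

lemma abscissa_inv (b θ : ℝ) : (abscissa b θ)⁻¹ = -(b * cos θ + radical b θ) := by
  apply inv_eq_of_mul_eq_one_right
  linear_combination -abscissa_mul b θ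

@[fun_prop]
lemma continuous_abscissa (b : ℝ) : Continuous (abscissa b) := by
  unfold abscissa; fun_prop

/-- The integrand of `I_{i,1}` with respect to the angle `θ`. -/
noncomputable def angularIntegrand (b : ℝ) (i : ℕ) (θ : ℝ) : ℝ :=
  b ^ 2 * sin θ ^ 2 * abscissa b θ ^ ((i : ℤ) - 1) / radical b θ

lemma continuous_angularIntegrand (b : ℝ) (i : ℕ) : Continuous (angularIntegrand b i) := by
  unfold angularIntegrand
  refine Continuous.div (Continuous.mul (by fun_prop) ?_) (by fun_prop)
    fun θ => (radical_pos b θ).ne'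
  exact (continuous_abscissa b).zpow₀ _ fun θ => Or.inl (abscissa_neg b θ).ne

lemma radical_add_pi (b θ : ℝ) : radical b (θ + π) = radical b θ := by
  simp [radical, cos_add_pi]

lemma abscissa_add_pi (b θ : ℝ) : abscissa b (θ + π) = -(b * cos θ) - radical b θ := by
  simp [abscissa, radical_add_pi, cos_add_pi]

lemma periodic_angularIntegrand (b : ℝ) (i : ℕ) :
    Function.Periodic (angularIntegrand b i) (2 * π) := fun θ => by
  simp [angularIntegrand, abscissa, radical, cos_add_two_pi, sin_add_two_pi]

/-- Pairing `θ` with `θ + π` pairs `x` with `1/x`, so the odd powers of `cos θ` drop out of the sum.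
-/
lemma integral_angularIntegrand (b : ℝ) (i : ℕ) (θ₀ : ℝ) :
    ∫ θ in θ₀..(θ₀ + 2 * π), angularIntegrand b i θ =
      ∫ θ in (0 : ℝ)..π, (angularIntegrand b i θ + angularIntegrand b i (θ + π)) := by
  have hc := continuous_angularIntegrand b i
  rw [(periodic_angularIntegrand b i).intervalIntegral_add_eq θ₀ 0,
    intervalIntegral.integral_add (hc.intervalIntegrable _ _)
      (Continuous.intervalIntegrable (by fun_prop) _ _),
    intervalIntegral.integral_comp_add_right (angularIntegrand b i), zero_add, zero_add, ← two_mul,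
    intervalIntegral.integral_add_adjacent_intervals (hc.intervalIntegrable _ _)
      (hc.intervalIntegrable _ _)]

lemma integral_angularIntegrand_zero (b θ₀ : ℝ) :
    ∫ θ in θ₀..(θ₀ + 2 * π), angularIntegrand b 0 θ = -(π * b ^ 2) := by
  have h : ∀ θ, angularIntegrand b 0 θ + angularIntegrand b 0 (θ + π) =
      -2 * b ^ 2 * sin θ ^ 2 := fun θ => by
    simp only [angularIntegrand, Nat.cast_zero, zero_sub, zpow_neg_one, abscissa_inv,
      radical_add_pi, cos_add_pi, sin_add_pi]
    have := (radical_pos b θ).ne'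
    field_simp
    ring
  simp only [integral_angularIntegrand, h, intervalIntegral.integral_const_mul, integral_sin_sq]
  simp
  ring

lemma integral_angularIntegrand_two (b θ₀ : ℝ) :
    ∫ θ in θ₀..(θ₀ + 2 * π), angularIntegrand b 2 θ = -(π * b ^ 2) := by
  have h : ∀ θ, angularIntegrand b 2 θ + angularIntegrand b 2 (θ + π) =
      -2 * b ^ 2 * sin θ ^ 2 := fun θ => by
    rw [angularIntegrand, angularIntegrand, show ((2 : ℕ) : ℤ) - 1 = 1 by norm_num, zpow_one,
      zpow_one, abscissa_add_pi, abscissa, radical_add_pi, sin_add_pi]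
    have := (radical_pos b θ).ne'
    field_simp
    ring
  simp only [integral_angularIntegrand, h, intervalIntegral.integral_const_mul, integral_sin_sq]
  simp
  ring

lemma integral_angularIntegrand_one (b θ₀ : ℝ) :
    ∫ θ in θ₀..(θ₀ + 2 * π), angularIntegrand b 1 θ =
      2 * ((1 + b ^ 2) * (∫ φ in (0 : ℝ)..π, 1 / radical b φ)
        - ∫ φ in (0 : ℝ)..π, radical b φ) := by
  have h : ∀ θ, angularIntegrand b 1 θ + angularIntegrand b 1 (θ + π) =
      2 * ((1 + b ^ 2) * (1 / radical b θ) - radical b θ) := fun θ => by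
    rw [angularIntegrand, angularIntegrand, show ((1 : ℕ) : ℤ) - 1 = 0 by norm_num, zpow_zero,
      zpow_zero, radical_add_pi, sin_add_pi]
    have := (radical_pos b θ).ne'
    field_simp
    rw [radical_sq]
    linear_combination 2 * b ^ 2 * sin_sq_add_cos_sq θ
  have hi := continuous_radical_inv b
  simp only [integral_angularIntegrand, h, intervalIntegral.integral_const_mul]
  rw [intervalIntegral.integral_sub (Continuous.intervalIntegrable (by fun_prop) _ _)
    (Continuous.intervalIntegrable (by fun_prop) _ _), intervalIntegral.integral_const_mul]

lemma integral_angularIntegrand_three (b θ₀ : ℝ) :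
    ∫ θ in θ₀..(θ₀ + 2 * π), angularIntegrand b 3 θ =
      2 / 3 * ((1 + 2 * b ^ 2) * (∫ φ in (0 : ℝ)..π, radical b φ)
        - (1 + b ^ 2) * ∫ φ in (0 : ℝ)..π, 1 / radical b φ) := by
  -- The cube arises from `x² + x⁻² = 4 D² - 2` and `b² sin² θ = 1 + b² - D²`, where `D` is the
  -- radical.
  have h : ∀ θ, angularIntegrand b 3 θ + angularIntegrand b 3 (θ + π) =
      2 * ((3 + 2 * b ^ 2) * radical b θ - (1 + b ^ 2) * (1 / radical b θ)
        - 2 * radical b θ ^ 3) := fun θ => by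
    rw [angularIntegrand, angularIntegrand, show ((3 : ℕ) : ℤ) - 1 = (2 : ℕ) by norm_num,
      zpow_natCast, zpow_natCast, abscissa_add_pi, abscissa, radical_add_pi, sin_add_pi]
    have h0 := (radical_pos b θ).ne'
    have hs : b ^ 2 * sin θ ^ 2 = 1 + b ^ 2 - radical b θ ^ 2 := by
      rw [radical_sq]; linear_combination b ^ 2 * sin_sq_add_cos_sq θ
    have hc : b ^ 2 * cos θ ^ 2 = radical b θ ^ 2 - 1 := by rw [radical_sq]; ring
    rw [neg_sq, hs]
    field_simp
    linear_combination (2 * (1 + b ^ 2 - radical b θ ^ 2)) * hc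
  have hi := continuous_radical_inv b
  have hcube := integral_radical_cube b
  simp only [integral_angularIntegrand, h, intervalIntegral.integral_const_mul]
  rw [intervalIntegral.integral_sub (Continuous.intervalIntegrable (by fun_prop) _ _)
    (Continuous.intervalIntegrable (by fun_prop) _ _),
    intervalIntegral.integral_sub (Continuous.intervalIntegrable (by fun_prop) _ _)
    (Continuous.intervalIntegrable (by fun_prop) _ _)]
  simp only [intervalIntegral.integral_const_mul]
  linear_combination (-4 / 3) * hcube

/-! ### The orbit as a circle -/

/-- The point of the orbit at angle `θ`. -/
noncomputable def orbitPoint (b θ : ℝ) : ℝ × ℝ :=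
  (abscissa b θ, b * sin θ * abscissa b θ / (abscissa b θ - 1))

/-- The level sets of the first integral are circles in the coordinates
`((x - 1 / x) / 2, y (1 - 1 / x))`. -/
lemma firstIntegral_eq {p : ℝ × ℝ} (hp : p.1 < 0) :
    firstIntegral p = (((p.1 - p.1⁻¹) / 2) ^ 2 + (p.2 * (1 - p.1⁻¹)) ^ 2) / 4 := by
  have := hp.ne
  unfold firstIntegral
  field_simp
  ring

lemma abscissa_sub_inv (b θ : ℝ) : (abscissa b θ - (abscissa b θ)⁻¹) / 2 = b * cos θ := by
  rw [abscissa_inv, abscissa]; ring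

lemma orbitPoint_snd_mul (b θ : ℝ) :
    (orbitPoint b θ).2 * (1 - (orbitPoint b θ).1⁻¹) = b * sin θ := by
  have h := abscissa_neg b θ
  have h1 : abscissa b θ - 1 ≠ 0 := by linarith
  have := h.ne
  simp only [orbitPoint]
  field_simp

/-- The quadratic equation for `x` has roots `b cos θ ± radical b θ`, and the one with the plus sign
is positive. -/
lemma eq_abscissa {b θ x : ℝ} (hx : x < 0) (h : (x - x⁻¹) / 2 = b * cos θ) :
    x = abscissa b θ := by
  have h0 := hx.ne
  have h1 : x ^ 2 - 1 = 2 * (b * cos θ) * x := by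
    rw [← h]; field_simp
  have h2 : (x - abscissa b θ) * (x - b * cos θ - radical b θ) = 0 := by
    unfold abscissa
    linear_combination h1 - radical_sq b θ
  rcases mul_eq_zero.1 h2 with h3 | h3
  · linarith
  · linarith [radical_add_pos b θ]

lemma eq_orbitPoint {b θ : ℝ} {p : ℝ × ℝ} (hx : p.1 < 0) (h : (p.1 - p.1⁻¹) / 2 = b * cos θ)
    (h' : p.2 * (1 - p.1⁻¹) = b * sin θ) : p = orbitPoint b θ := by
  have h1 := eq_abscissa hx h
  refine Prod.ext h1 ?_
  simp only [orbitPoint]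
  rw [← h1, ← h']
  have h0 := hx.ne
  have : p.1 - 1 ≠ 0 := by linarith
  field_simp

lemma orbitPoint_mem {h b : ℝ} (hb : b ^ 2 = 4 * h) (θ : ℝ) : orbitPoint b θ ∈ orbit h := by
  refine ⟨abscissa_neg b θ, ?_⟩
  rw [firstIntegral_eq (abscissa_neg b θ), orbitPoint_snd_mul]
  simp only [orbitPoint, abscissa_sub_inv]
  linear_combination (b ^ 2 / 4) * sin_sq_add_cos_sq θ + hb / 4

lemma hasDerivAt_abscissa (b θ : ℝ) :
    HasDerivAt (abscissa b) (b * sin θ * abscissa b θ / radical b θ) θ := by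
  refine (((hasDerivAt_cos θ).const_mul b).sub (hasDerivAt_radical b θ)).congr_deriv ?_
  have := (radical_pos b θ).ne'
  unfold abscissa
  field_simp
  ring

lemma abscissa_sq_add_one (b θ : ℝ) :
    abscissa b θ ^ 2 + 1 = -2 * abscissa b θ * radical b θ := by
  unfold abscissa
  linear_combination -radical_sq b θ

/-- The scalar is the reciprocal of the angular velocity `(x² + 1)/2` of the flow; being positive,
it gives the orientation. -/
lemma hasDerivAt_orbitPoint (b θ : ℝ) :
    HasDerivAt (orbitPoint b) ((2 / (abscissa b θ ^ 2 + 1)) • vectorField (orbitPoint b θ)) θ := by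
  have hx := abscissa_neg b θ
  have hx0 := hx.ne
  have hx1 : abscissa b θ - 1 ≠ 0 := by linarith
  have hr := (radical_pos b θ).ne'
  have h1 := hasDerivAt_abscissa b θ
  have h2 := ((((hasDerivAt_sin θ).const_mul b).mul h1).div (h1.sub_const 1) hx1)
  refine (h1.prodMk h2).congr_deriv (Prod.ext ?_ ?_)
  · simp only [vectorField, orbitPoint, Prod.smul_mk, smul_eq_mul, abscissa_sq_add_one]
    field_simp
    ring
  · have hc := abscissa_sub_inv b θ
    have hq := abscissa_sq_add_one b θ
    simp only [vectorField, orbitPoint, Prod.smul_mk, smul_eq_mul, Pi.mul_apply]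
    rw [← hc]
    generalize abscissa b θ = x at *
    obtain hr' : radical b θ = -(x ^ 2 + 1) / (2 * x) := by rw [hq]; field_simp
    rw [hr']
    have : x ^ 2 + 1 ≠ 0 := by positivity
    field_simp
    ring

lemma contDiff_orbitPoint (b : ℝ) : ContDiff ℝ 1 (orbitPoint b) := by
  have hr : ContDiff ℝ 1 (radical b) := by
    unfold radical
    exact ContDiff.sqrt (by fun_prop) fun θ => by positivity
  have hx : ContDiff ℝ 1 (abscissa b) := by
    unfold abscissa
    fun_prop
  refine hx.prodMk (ContDiff.div (by fun_prop) (by fun_prop) fun θ => ?_)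
  have := abscissa_neg b θ
  linarith

lemma exists_int_of_cos_eq_sin_eq {θ ψ : ℝ} (hc : cos θ = cos ψ) (hs : sin θ = sin ψ) :
    ∃ n : ℤ, θ - ψ = 2 * π * n :=
  Real.Angle.angle_eq_iff_two_pi_dvd_sub.1 (Real.Angle.cos_sin_inj hc hs)

lemma orbitPoint_inj {b θ ψ : ℝ} (hb : b ≠ 0) (h : orbitPoint b θ = orbitPoint b ψ) :
    cos θ = cos ψ ∧ sin θ = sin ψ := by
  have h1 : abscissa b θ = abscissa b ψ := congrArg Prod.fst h
  have h2 := orbitPoint_snd_mul b θ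
  rw [h, orbitPoint_snd_mul] at h2
  have h3 := abscissa_sub_inv b θ
  rw [h1, abscissa_sub_inv] at h3
  exact ⟨(mul_left_cancel₀ hb h3).symm, (mul_left_cancel₀ hb h2).symm⟩

/-- Every vector is given by polar coordinates with an angle in `[-π, π]`. -/
lemma exists_polar {b s t : ℝ} (hb : 0 ≤ b) (h : s ^ 2 + t ^ 2 = b ^ 2) :
    ∃ θ ∈ Icc (-π) π, s = b * cos θ ∧ t = b * sin θ := by
  have hn : ‖(⟨s, t⟩ : ℂ)‖ = b := by
    rw [Complex.norm_def, Complex.normSq_mk, ← sq, ← sq, h, Real.sqrt_sq hb]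
  refine ⟨Complex.arg ⟨s, t⟩, ⟨(Complex.neg_pi_lt_arg _).le, Complex.arg_le_pi _⟩, ?_, ?_⟩
  · have := Complex.norm_mul_cos_arg ⟨s, t⟩
    rw [hn] at this
    exact this.symm
  · have := Complex.norm_mul_sin_arg ⟨s, t⟩
    rw [hn] at this
    exact this.symm

lemma isOrbitParam_orbitPoint {h b : ℝ} (hb0 : 0 < b) (hb : b ^ 2 = 4 * h) :
    IsOrbitParam h (-π) π (orbitPoint b) where
  lt := by linarith [pi_pos]
  contDiffOn := (contDiff_orbitPoint b).contDiffOn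
  closed := by simp [orbitPoint, abscissa, radical]
  injOn := by
    intro θ hθ ψ hψ e
    obtain ⟨hc, hs⟩ := orbitPoint_inj hb0.ne' e
    obtain ⟨n, hn⟩ := exists_int_of_cos_eq_sin_eq hc hs
    have hp := pi_pos
    have h1 : (n : ℝ) < 1 := by nlinarith [hθ.2, hψ.1]
    have h2 : (-1 : ℝ) < n := by nlinarith [hθ.1, hψ.2]
    have h3 : n = 0 := by
      have : n < 1 := by exact_mod_cast h1
      have : -1 < n := by exact_mod_cast h2
      omega
    rw [h3] at hn
    simp at hn
    linarith
  image_eq := by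
    refine Subset.antisymm (image_subset_iff.2 fun θ _ => orbitPoint_mem hb θ) ?_
    rintro p ⟨hp, hH⟩
    rw [firstIntegral_eq hp] at hH
    obtain ⟨θ, hθ, h1, h2⟩ := exists_polar hb0.le
      (show ((p.1 - p.1⁻¹) / 2) ^ 2 + (p.2 * (1 - p.1⁻¹)) ^ 2 = b ^ 2 by linarith)
    exact ⟨θ, hθ, (eq_orbitPoint hp h1 h2).symm⟩
  flow := fun θ hθ => ⟨2 / (abscissa b θ ^ 2 + 1), by positivity,
    (hasDerivAt_orbitPoint b θ).hasDerivWithinAt.derivWithin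
      (uniqueDiffOn_Icc (by linarith [pi_pos]) θ hθ)⟩

/-! ### Angle functions of arbitrary parametrizations -/

/-- A plane curve that rotates about the origin with continuous angular velocity `ω` has an angle
function with derivative `ω`. -/
lemma exists_angle {a b r : ℝ} (hr : 0 ≤ r) {s t ω : ℝ → ℝ} (hab : a < b)
    (hω : ContinuousOn ω (Icc a b))
    (hs : ∀ u ∈ Icc a b, HasDerivWithinAt s (-(ω u * t u)) (Icc a b) u)
    (ht : ∀ u ∈ Icc a b, HasDerivWithinAt t (ω u * s u) (Icc a b) u)
    (h : s a ^ 2 + t a ^ 2 = r ^ 2) :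
    ∃ θ : ℝ → ℝ, (∀ u ∈ Icc a b, HasDerivWithinAt θ (ω u) (Icc a b) u) ∧
      ∀ u ∈ Icc a b, s u = r * cos (θ u) ∧ t u = r * sin (θ u) := by
  obtain ⟨θ₀, -, hc, hsn⟩ := exists_polar hr h
  -- A continuous extension to `ℝ` makes the antiderivative differentiable at the endpoints too.
  set w : ℝ → ℝ := IccExtend hab.le ((Icc a b).domRestrict ω) with hw
  have hwc : Continuous w := (continuousOn_iff_continuous_domRestrict.1 hω).Icc_extend'
  have hwω : ∀ u ∈ Icc a b, w u = ω u := fun u hu => by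
    rw [hw, IccExtend_of_mem _ _ hu]; rfl
  set θ : ℝ → ℝ := fun u => θ₀ + ∫ v in a..u, w v with hθ
  have hθd : ∀ u ∈ Icc a b, HasDerivWithinAt θ (ω u) (Icc a b) u := fun u hu => by
    rw [← hwω u hu]
    exact ((hwc.integral_hasStrictDerivAt a u).hasDerivAt.const_add θ₀).hasDerivWithinAt
  have hθa : θ a = θ₀ := by simp [hθ]
  have const : ∀ f : ℝ → ℝ, (∀ u ∈ Icc a b, HasDerivWithinAt f 0 (Icc a b) u) →
      ∀ u ∈ Icc a b, f u = f a := fun f hf =>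
    constant_of_derivWithin_zero (fun u hu => (hf u hu).differentiableWithinAt)
      fun u hu => (hf u (Ico_subset_Icc_self hu)).derivWithin
        (uniqueDiffOn_Icc hab u (Ico_subset_Icc_self hu))
  -- Rotating `(s, t)` back by `θ` gives a constant vector; these are its two components.
  have h1 := const (fun u => s u * cos (θ u) + t u * sin (θ u)) fun u hu =>
    (((hs u hu).mul (hθd u hu).cos).add ((ht u hu).mul (hθd u hu).sin)).congr_deriv (by ring)
  have h2 := const (fun u => t u * cos (θ u) - s u * sin (θ u)) fun u hu =>
    (((ht u hu).mul (hθd u hu).cos).sub ((hs u hu).mul (hθd u hu).sin)).congr_deriv (by ring)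
  refine ⟨θ, hθd, fun u hu => ?_⟩
  have h1 := h1 u hu
  have h2 := h2 u hu
  simp only [hθa, hc, hsn] at h1 h2
  have e := sin_sq_add_cos_sq (θ u)
  have e₀ := sin_sq_add_cos_sq θ₀
  constructor
  · linear_combination (cos (θ u)) * h1 - sin (θ u) * h2 - s u * e + r * cos (θ u) * e₀
  · linear_combination (sin (θ u)) * h1 + cos (θ u) * h2 - t u * e + r * sin (θ u) * e₀

/-- A parametrization of the orbit in the direction of the flow has a strictly increasing angle
function. -/
lemma IsOrbitParam.exists_angle {h a b r : ℝ} {γ : ℝ → ℝ × ℝ} (H : IsOrbitParam h a b γ)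
    (hr : 0 < r) (hrh : r ^ 2 = 4 * h) :
    ∃ θ ω : ℝ → ℝ, ContinuousOn ω (Icc a b) ∧ (∀ t ∈ Icc a b, 0 < ω t) ∧
      (∀ t ∈ Icc a b, HasDerivWithinAt θ (ω t) (Icc a b) t) ∧
      (∀ t ∈ Icc a b, γ t = orbitPoint r (θ t)) := by
  have hγ : ∀ t ∈ Icc a b, HasDerivWithinAt γ (derivWithin γ (Icc a b) t) (Icc a b) t :=
    fun t ht => (H.contDiffOn.differentiableOn one_ne_zero t ht).hasDerivWithinAt
  have hx : ∀ t ∈ Icc a b, HasDerivWithinAt (fun t => (γ t).1)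
      (derivWithin γ (Icc a b) t).1 (Icc a b) t := fun t ht => (hγ t ht).fst
  have hy : ∀ t ∈ Icc a b, HasDerivWithinAt (fun t => (γ t).2)
      (derivWithin γ (Icc a b) t).2 (Icc a b) t := fun t ht => (hγ t ht).snd
  have hmem : ∀ t ∈ Icc a b, γ t ∈ orbit h := fun t ht => H.image_eq ▸ mem_image_of_mem γ ht
  have hx0 : ∀ t ∈ Icc a b, (γ t).1 ≠ 0 := fun t ht => (hmem t ht).1.ne
  have hγc : ContinuousOn γ (Icc a b) := H.contDiffOn.continuousOn
  have hγ'c : ContinuousOn (derivWithin γ (Icc a b)) (Icc a b) :=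
    H.contDiffOn.continuousOn_derivWithin (uniqueDiffOn_Icc H.lt) le_rfl
  set s : ℝ → ℝ := fun t => ((γ t).1 - (γ t).1⁻¹) / 2
  set v : ℝ → ℝ := fun t => (γ t).2 * (1 - (γ t).1⁻¹)
  have hsv : ∀ t ∈ Icc a b, s t ^ 2 + v t ^ 2 = r ^ 2 := fun t ht => by
    have := (hmem t ht).2
    rw [firstIntegral_eq (hmem t ht).1] at this
    simp only [s, v]
    linarith
  set s' : ℝ → ℝ := fun t => ((derivWithin γ (Icc a b) t).1
    + (derivWithin γ (Icc a b) t).1 / (γ t).1 ^ 2) / 2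
  set v' : ℝ → ℝ := fun t => (derivWithin γ (Icc a b) t).2 * (1 - (γ t).1⁻¹)
    + (γ t).2 * ((derivWithin γ (Icc a b) t).1 / (γ t).1 ^ 2)
  have hs' : ∀ t ∈ Icc a b, HasDerivWithinAt s (s' t) (Icc a b) t := fun t ht =>
    (((hx t ht).sub ((hx t ht).inv (hx0 t ht))).div_const 2).congr_deriv (by simp only [s']; ring)
  have hv' : ∀ t ∈ Icc a b, HasDerivWithinAt v (v' t) (Icc a b) t := fun t ht =>
    ((hy t ht).mul (((hx t ht).inv (hx0 t ht)).const_sub 1)).congr_deriv (by simp only [v', Pi.inv_apply]; ring)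
  -- The factor `c` in `H.flow` is chosen pointwise, so its continuity is not given; this formula
  -- for the angular velocity is visibly continuous.
  set ω : ℝ → ℝ := fun t => (s t * v' t - v t * s' t) / r ^ 2
  have hflow : ∀ t ∈ Icc a b, 0 < ω t ∧ s' t = -(ω t * v t) ∧ v' t = ω t * s t := by
    intro t ht
    obtain ⟨c, hc, e⟩ := H.flow t ht
    have h0 := hx0 t ht
    have es : s' t = -(c * ((γ t).1 ^ 2 + 1) / 2 * v t) := by
      simp only [s', v, e, vectorField, Prod.smul_mk, smul_eq_mul]
      field_simp
      ring
    have ev : v' t = c * ((γ t).1 ^ 2 + 1) / 2 * s t := by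
      simp only [v', s, e, vectorField, Prod.smul_mk, smul_eq_mul]
      field_simp
      ring
    have eω : ω t = c * ((γ t).1 ^ 2 + 1) / 2 := by
      simp only [ω]
      rw [es, ev, div_eq_iff (by positivity), ← hsv t ht]
      ring
    exact ⟨by rw [eω]; positivity, by rw [eω, es], by rw [eω, ev]⟩
  have hωc : ContinuousOn ω (Icc a b) := by
    have hx0' : ∀ t ∈ Icc a b, (γ t).1 ^ 2 ≠ 0 := fun t ht => pow_ne_zero 2 (hx0 t ht)
    simp only [ω, s, v, s', v']
    fun_prop (disch := assumption)
  obtain ⟨θ, hθ, hsvθ⟩ := _root_.exists_angle hr.le H.lt hωc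
    (fun t ht => (hs' t ht).congr_deriv (hflow t ht).2.1)
    (fun t ht => (hv' t ht).congr_deriv (hflow t ht).2.2) (hsv a (left_mem_Icc.2 H.lt.le))
  exact ⟨θ, ω, hωc, fun t ht => (hflow t ht).1, hθ, fun t ht =>
    eq_orbitPoint (hmem t ht).1 (hsvθ t ht).1 (hsvθ t ht).2⟩

/-- The angle of a parametrization of the orbit increases by exactly one turn. -/
lemma IsOrbitParam.angle_end {h a b r : ℝ} {γ : ℝ → ℝ × ℝ} (H : IsOrbitParam h a b γ)
    (hr : r ≠ 0) {θ ω : ℝ → ℝ} (hω : ∀ t ∈ Icc a b, 0 < ω t)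
    (hθ : ∀ t ∈ Icc a b, HasDerivWithinAt θ (ω t) (Icc a b) t)
    (hγ : ∀ t ∈ Icc a b, γ t = orbitPoint r (θ t)) : θ b = θ a + 2 * π := by
  have ha := left_mem_Icc.2 H.lt.le
  have hb := right_mem_Icc.2 H.lt.le
  have hcont : ContinuousOn θ (Icc a b) := fun t ht => (hθ t ht).continuousWithinAt
  have hmono : StrictMonoOn θ (Icc a b) :=
    strictMonoOn_of_hasDerivWithinAt_pos (convex_Icc a b) hcont
      (fun t ht => (hθ t (interior_subset ht)).mono interior_subset)
      fun t ht => hω t (interior_subset ht)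
  have hlt : θ a < θ b := hmono ha hb H.lt
  have hclosed := H.closed
  rw [hγ a ha, hγ b hb] at hclosed
  obtain ⟨hc, hs⟩ := orbitPoint_inj hr hclosed
  obtain ⟨n, hn⟩ := exists_int_of_cos_eq_sin_eq hc.symm hs.symm
  have hn1 : (1 : ℝ) ≤ n := by
    have h0 : (0 : ℝ) < n := by
      by_contra! h0
      nlinarith [pi_pos]
    have h1 : 0 < n := by exact_mod_cast h0
    exact_mod_cast h1
  have hge : θ a + 2 * π ≤ θ b := by nlinarith [pi_pos]
  -- More than one turn would bring the curve back to `γ a` at an interior time, against injectivity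
  -- on `Ico a b`.
  refine (hge.eq_or_lt.resolve_right fun hgt => ?_).symm
  obtain ⟨t, ht, e⟩ := intermediate_value_Ioo H.lt.le hcont
    (show θ a + 2 * π ∈ Ioo (θ a) (θ b) from ⟨by linarith [pi_pos], hgt⟩)
  have e' : γ t = γ a := by
    rw [hγ a ha, hγ t (Ioo_subset_Icc_self ht), e]
    simp [orbitPoint, abscissa, radical]
  exact ht.1.ne' (H.injOn (Ioo_subset_Ico_self ht) (left_mem_Ico.2 H.lt) e')

/-- The integral `I_{i,1}` over any parametrization, as an integral over the angle. -/
lemma IsOrbitParam.orbitIntegral_eq {h a b r : ℝ} {γ : ℝ → ℝ × ℝ} (H : IsOrbitParam h a b γ)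
    (hr : 0 < r) (hrh : r ^ 2 = 4 * h) (i : ℕ) :
    ∃ θ₀ : ℝ, orbitIntegral i 1 a b γ =
      ∫ θ in θ₀..(θ₀ + 2 * π), angularIntegrand r i θ := by
  obtain ⟨θ, ω, hωc, hω, hθ, hγ⟩ := H.exists_angle hr hrh
  refine ⟨θ a, ?_⟩
  rw [← H.angle_end hr.ne' hω hθ hγ]
  have hI : uIcc a b = Icc a b := uIcc_of_le H.lt.le
  rw [← intervalIntegral.integral_comp_mul_deriv'' (f := θ) (f' := ω)
    (hI ▸ fun t ht => (hθ t ht).continuousWithinAt)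
    (fun t ht => by
      rw [min_eq_left H.lt.le, max_eq_right H.lt.le] at ht
      exact ((hθ t (Ioo_subset_Icc_self ht)).hasDerivAt (Icc_mem_nhds ht.1 ht.2)).hasDerivWithinAt)
    (hI ▸ hωc) (continuous_angularIntegrand r i).continuousOn]
  refine intervalIntegral.integral_congr fun t ht => ?_
  rw [hI] at ht
  have hd : (derivWithin γ (Icc a b) t).1 =
      r * sin (θ t) * abscissa r (θ t) / radical r (θ t) * ω t := by
    have h1 : HasDerivWithinAt (fun t => (γ t).1) _ (Icc a b) t :=
      ((hasDerivAt_abscissa r (θ t)).comp_hasDerivWithinAt t (hθ t ht)).congr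
        (fun u hu => by rw [hγ u hu]; rfl) (by rw [hγ t ht]; rfl)
    exact (uniqueDiffOn_Icc H.lt t ht).eq_deriv _
      (H.contDiffOn.differentiableOn one_ne_zero t ht).hasDerivWithinAt.fst h1
  have hx := abscissa_neg r (θ t)
  have hx0 := hx.ne
  have hx1 : abscissa r (θ t) - 1 ≠ 0 := by linarith
  -- The factor `x ^ 2` comes from `y` and `dx`, one `x` each; the denominator `x - 1` of `y`
  -- cancels the weight.
  have hz : abscissa r (θ t) ^ ((i : ℤ) - 1) =
      abscissa r (θ t) ^ ((i : ℤ) - 3) * abscissa r (θ t) ^ 2 := by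
    rw [← zpow_natCast _ 2, ← zpow_add₀ hx0]
    congr 1
    push_cast
    ring
  simp only [hd, hγ t ht, orbitPoint, Function.comp, angularIntegrand, hz, pow_one]
  have := (radical_pos r (θ t)).ne'
  field_simp

/-! ### The closed formulas -/

theorem lemma2p4 (h : ℝ) (hh : 0 < h) :
    (0 < modulus h ∧ modulus h < 1) ∧
    (∃ (a b : ℝ) (γ : ℝ → ℝ × ℝ), IsOrbitParam h a b γ) ∧
    ∀ (a b : ℝ) (γ : ℝ → ℝ × ℝ), IsOrbitParam h a b γ →
      orbitIntegral 1 1 a b γ =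
          (16 * h + 2) / √(8 * h + 1 + 4 * √(4 * h ^ 2 + h)) * ellipticK (modulus h)
          - 2 / √(8 * h + 1 - 4 * √(4 * h ^ 2 + h)) * ellipticE (modulus h) ∧
      orbitIntegral 3 1 a b γ =
          (16 * h + 2) / (3 * √(8 * h + 1 - 4 * √(4 * h ^ 2 + h))) * ellipticE (modulus h)
          - (16 * h + 2 - 8 * √(4 * h ^ 2 + h)) /
              (3 * √(8 * h + 1 - 4 * √(4 * h ^ 2 + h))) * ellipticK (modulus h) ∧
      orbitIntegral 0 1 a b γ = -4 * π * h ∧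
      orbitIntegral 2 1 a b γ = -4 * π * h := by
  obtain ⟨r, hr, hrh⟩ : ∃ r : ℝ, 0 < r ∧ r ^ 2 = 4 * h :=
    ⟨√(4 * h), by positivity, Real.sq_sqrt (by positivity)⟩
  -- In terms of `r` and `c` all nested radicals open up: `√(4h² + h) = c r / 2` and `8h + 1 ±
  -- 4√(4h² + h) = (c ± r)²`.
  obtain ⟨c, hc, hcr⟩ : ∃ c : ℝ, 0 < c ∧ c ^ 2 = 1 + r ^ 2 :=
    ⟨√(1 + r ^ 2), by positivity, Real.sq_sqrt (by positivity)⟩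
  obtain rfl : h = r ^ 2 / 4 := by linarith
  have hrc : r < c := by nlinarith
  have h1 : √(4 * (r ^ 2 / 4) ^ 2 + r ^ 2 / 4) = c * r / 2 := by
    rw [Real.sqrt_eq_iff_eq_sq (by positivity) (by positivity)]
    linear_combination (-r ^ 2 / 4) * hcr
  have h2 : 8 * (r ^ 2 / 4) + 1 + 4 * (c * r / 2) = (c + r) ^ 2 := by
    linear_combination -hcr
  have h3 : 8 * (r ^ 2 / 4) + 1 - 4 * (c * r / 2) = (c - r) ^ 2 := by
    linear_combination -hcr
  have hk : modulus (r ^ 2 / 4) ^ 2 = 4 * c * r / (c + r) ^ 2 := by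
    rw [modulus, h1, h2, mul_pow, mul_pow, Real.sq_sqrt zero_le_two,
      Real.sq_sqrt (by positivity)]
    ring
  have hk0 : 0 < modulus (r ^ 2 / 4) := by
    rw [modulus, h1, h2]
    positivity
  have hk1 : modulus (r ^ 2 / 4) < 1 := by
    rw [← sq_lt_one_iff₀ hk0.le, hk, div_lt_one (by positivity)]
    nlinarith [sq_pos_of_pos (sub_pos.2 hrc)]
  refine ⟨⟨hk0, hk1⟩, ⟨-π, π, orbitPoint r, isOrbitParam_orbitPoint hr hrh⟩, ?_⟩
  intro a b γ H
  have hinv : 1 / (c - r) = c + r := by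
    rw [div_eq_iff (sub_pos.2 hrc).ne']
    linear_combination -hcr
  rw [h1, h2, h3, Real.sqrt_sq (by positivity), Real.sqrt_sq (sub_pos.2 hrc).le,
    ellipticK_landen hc hr.le hcr hk, ellipticE_landen hc hr.le hcr hk]
  refine ⟨?_, ?_, ?_, ?_⟩
  · obtain ⟨θ₀, e⟩ := H.orbitIntegral_eq hr hrh 1
    rw [e, integral_angularIntegrand_one, div_eq_mul_one_div 2 (c - r), hinv]
    field_simp
    ring
  · obtain ⟨θ₀, e⟩ := H.orbitIntegral_eq hr hrh 3
    rw [e, integral_angularIntegrand_three, div_mul_eq_div_mul_one_div _ 3 (c - r),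
      div_mul_eq_div_mul_one_div _ 3 (c - r), hinv]
    have hcancel : (c + r) * ((2 * (∫ φ in (0 : ℝ)..π, radical r φ)
        - ∫ φ in (0 : ℝ)..π, 1 / radical r φ) / (2 * (c + r))) =
        (2 * (∫ φ in (0 : ℝ)..π, radical r φ) - ∫ φ in (0 : ℝ)..π, 1 / radical r φ) / 2 := by
      field_simp
    rw [mul_assoc (_ / 3), hcancel]
    linear_combination
      ((∫ φ in (0 : ℝ)..π, 1 / radical r φ) / 3 * (1 + c ^ 2 - r ^ 2 - (c + r) ^ 2)) * hcr
  · obtain ⟨θ₀, e⟩ := H.orbitIntegral_eq hr hrh 0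
    rw [e, integral_angularIntegrand_zero]
    ring
  · obtain ⟨θ₀, e⟩ := H.orbitIntegral_eq hr hrh 2
    rw [e, integral_angularIntegrand_two]
    ring
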